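/- A \emph{space of orderings} is a pair $(X,G)$ where $X$ is a nonempty set and $G$ is a subgroup of $\{1,-1\}^X$ that contains the constant function $-1$, separates the points of $X$, and satisfies the following two axioms. Here $\chi(G)$ is the group of homomorphisms $G\to\{1,-1\}$, each $x\in X$ is identified with the character $a\mapsto a(x)$ of $G$, and $D(a,b)=\{c\in G:\ \forall x\in X,\ c(x)=a(x)\text{ or }c(x)=b(x)\}$ for $a,b\in G$. (1) If $x\in\chi(G)$ satisfies $x(-1)=-1$ and $D(a,b)\subseteq\ker x$ for all $a,b\in\ker x$, then $x\in X$. (2) If $a_1,a_2,a_3,b,c\in G$, $b\in D(a_1,c)$ and $c\in D(a_2,a_3)$, then there is $d\in G$ with $b\in D(d,a_3)$ and $d\in D(a_1,a_2)$. A \emph{fan in} $(X,G)$ is a nonempty set of the form $V=\bigcap_{a\in S}\{x\in X:a(x)=1\}$ with $S\subseteq G$ such that $V$ is identified with the set of all characters $x$ of $G|_V$ with $x(-1)=-1$. The \emph{stability index} of $(X,G)$ is the maximum $n$ such that there is a fan in $(X,G)$ with $2^n$ elements (or $\infty$ if there is no maximum), and $(X,G)$ is \emph{SAP} if its stability index is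 $1$. For a subgroup $G_0$ of $G$ with $-1\in G_0$, let $X_0=X|_{G_0}$ be the set of restrictions to $G_0$ of the characters in $X$; the pair $(X_0,G_0)$ is a \emph{quotient space} of $(X,G)$ if it is a space of orderings, where $G_0$ is regarded as a group of functions on $X_0$ by evaluation. \textbf{Theorem.} Let $(X,G)$ be an SAP space of orderings, let $G_0$ be a subgroup of index $2$ in $G$ with $-1\in G_0$, and let $\gamma\in\chi(G)$ be the character with $\ker\gamma=G_0$. If $\gamma\in X^4$, i.e. $\gamma=\sigma_1\sigma_2\sigma_3\sigma_4$ for some (not necessarily distinct) $\sigma_1,\dots,\sigma_4\in X$, then $(X_0,G_0)$ is a quotient space of $(X,G)$. -/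

import Mathlib

namespace SpaceOfOrderings

universe u

/-! A pair `(X, G)`, with `G` a subgroup of `{1, -1}^X`, is given by a type `X` and
`G : Subgroup (X → ℤˣ)`. A character of a group `A` is a homomorphism `A →* ℤˣ`. -/

variable {X : Type u}

/-- The natural map `X → χ(G)`: the point `x` is sent to the character `a ↦ a x`. -/
def evalChar (G : Subgroup (X → ℤˣ)) (x : X) : G →* ℤˣ :=
  (Pi.evalMonoidHom (fun _ : X => ℤˣ) x).comp G.subtype

/-- The value set `D(a, b)`: all `c ∈ G` such that for every `x`, `c x = a x` or `c x = b x`. -/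
def valueSet (G : Subgroup (X → ℤˣ)) (a b : G) : Set G :=
  {c | ∀ x : X, c.1 x = a.1 x ∨ c.1 x = b.1 x}

/-- The pair `(X, G)` is a space of orderings. -/
structure IsSpaceOfOrderings (G : Subgroup (X → ℤˣ)) : Prop where
  nonempty : Nonempty X
  neg_one_mem : (-1 : X → ℤˣ) ∈ G
  separates : ∀ x y : X, x ≠ y → ∃ a ∈ G, a x ≠ a y
  exists_point : ∀ χ : G →* ℤˣ, χ ⟨-1, neg_one_mem⟩ = -1 →
    (∀ a b : G, a ∈ χ.ker → b ∈ χ.ker → ∀ c ∈ valueSet G a b, c ∈ χ.ker) →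
    ∃ x : X, evalChar G x = χ
  assoc : ∀ a₁ a₂ a₃ b c : G, b ∈ valueSet G a₁ c → c ∈ valueSet G a₂ a₃ →
    ∃ d : G, b ∈ valueSet G d a₃ ∧ d ∈ valueSet G a₁ a₂

/-- The pair `(X, G)` is a fan: `X` is nonempty and the natural map identifies `X` with the set
of all characters `χ` of `G` such that `χ (-1) = -1`. -/
structure IsFan (G : Subgroup (X → ℤˣ)) : Prop where
  nonempty : Nonempty X
  neg_one_mem : (-1 : X → ℤˣ) ∈ G
  existsUnique_point : ∀ χ : G →* ℤˣ, χ ⟨-1, neg_one_mem⟩ = -1 → ∃! x : X, evalChar G x = χ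

/-- The Harrison set `H(a)`. -/
def harrison (G : Subgroup (X → ℤˣ)) (a : G) : Set X := {x | a.1 x = 1}

/-- `V ⊆ X` is a subspace of `(X, G)`: an intersection of Harrison sets. -/
def IsSubspace (G : Subgroup (X → ℤˣ)) (V : Set X) : Prop :=
  ∃ S : Set G, V = ⋂ a ∈ S, harrison G a

/-- Restriction of functions on `X` to a subset `V`. -/
def restrictHom (V : Set X) : (X → ℤˣ) →* (V → ℤˣ) where
  toFun a := fun x => a x
  map_one' := rfl
  map_mul' _ _ := rfl

/-- The group `G|_V` of all restrictions `a|_V`, `a ∈ G`. -/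
def restrictGroup (G : Subgroup (X → ℤˣ)) (V : Set X) : Subgroup (V → ℤˣ) :=
  G.map (restrictHom V)

/-- `V` is a fan in `(X, G)`: a subspace such that `(V, G|_V)` is a fan. -/
def IsFanIn (G : Subgroup (X → ℤˣ)) (V : Set X) : Prop :=
  IsSubspace G V ∧ IsFan (restrictGroup G V)

/-- The stability index: the largest `n` such that there is a fan in `(X, G)` with `2 ^ n`
elements, or `∞` if there are such fans for arbitrarily large `n`. -/
noncomputable def stabilityIndex (G : Subgroup (X → ℤˣ)) : ℕ∞ :=
  ⨆ (n : ℕ) (_ : ∃ V : Set X, IsFanIn G V ∧ V.encard = 2 ^ n), (n : ℕ∞)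

/-- SAP spaces: those of stability index one. -/
def IsSAP (G : Subgroup (X → ℤˣ)) : Prop := stabilityIndex G = 1

/-- `X^k`: the set of all products of `k` not necessarily distinct characters from `X`. -/
def charPow (G : Subgroup (X → ℤˣ)) (k : ℕ) : Set (G →* ℤˣ) :=
  {γ | ∃ σ : Fin k → X, γ = ∏ i, evalChar G (σ i)}

/-- `X₀ = X|_{G₀}`: the set of all restrictions to `G₀` of characters from `X`. -/
def quotientSet (G : Subgroup (X → ℤˣ)) (G₀ : Subgroup G) : Set (G₀ →* ℤˣ) :=
  Set.range fun x : X => (evalChar G x).comp G₀.subtype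

/-- The natural map `G₀ → {1, -1}^{X₀}`, `g ↦ (σ ↦ σ g)`. -/
def quotientHom (G : Subgroup (X → ℤˣ)) (G₀ : Subgroup G) :
    G₀ →* (quotientSet G G₀ → ℤˣ) where
  toFun g := fun σ => σ.1 g
  map_one' := funext fun σ => map_one σ.1
  map_mul' g h := funext fun σ => map_mul σ.1 g h

/-- This map is injective, so its image is a copy of `G₀`. -/
theorem quotientHom_injective (G : Subgroup (X → ℤˣ)) (G₀ : Subgroup G) :
    Function.Injective (quotientHom G G₀) := by
  intro g h hgh
  apply Subtype.ext
  apply Subtype.ext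
  funext x
  exact congrFun hgh ⟨_, x, rfl⟩

/-- The quotient structure `(X₀, G₀)`, with `G₀` regarded as a group of functions on `X₀`. -/
def quotientStructure (G : Subgroup (X → ℤˣ)) (G₀ : Subgroup G) :
    Subgroup (quotientSet G G₀ → ℤˣ) :=
  (quotientHom G G₀).range

/-- The quotient structure `(X₀, G₀)` is a quotient space: it is a space of orderings. -/
def IsQuotientSpace (G : Subgroup (X → ℤˣ)) (G₀ : Subgroup G) : Prop :=
  IsSpaceOfOrderings (quotientStructure G G₀)

end SpaceOfOrderings

namespace SpaceOfOrderings

/-! In an SAP space, `G` is closed under gluing (`exists_glue`): with `a` and `b` it contains the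
function that is 1 where `a = 1` and `b` elsewhere. Proof: a glued function outside `G` would, by
Zorn's lemma, fail to come from `G` on a minimal subspace. Minimality makes value sets there so
small that the product of three distinct points of the subspace is again a point. This gives a
four-element fan, contradicting SAP; with at most two points every function comes from `G`.

If two of the `σ i` coincide they cancel, so `G₀` is defined by equality of values at two points and
is itself closed under gluing. Otherwise `G₀` is the condition that the values at four distinct
points have product 1. For axiom (1), a character either is covered by a lattice argument inside
`G₀` or is trivial on the common kernel of the four points, hence is one of them. For axiom (2),
take `d` from `G`. If `d` may take either sign at some `σ i`, it can be flipped there alone, by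
gluing; if it is forced at all four points, a parity count (`prod_eq_one_of_forced`) puts it in
`G₀`. -/

variable {X : Type*} {G : Subgroup (X → ℤˣ)}

/-! ### Value sets -/

theorem mul_mem_valueSet {a b c : G} (h : c ∈ valueSet G a b) (k : G) :
    k * c ∈ valueSet G (k * a) (k * b) := fun x =>
  (h x).imp (congrArg (k.1 x * ·)) (congrArg (k.1 x * ·))

theorem valueSet_comm {a b c : G} (h : c ∈ valueSet G a b) : c ∈ valueSet G b a := fun x =>
  (h x).symm

theorem left_mem_valueSet (a b : G) : a ∈ valueSet G a b := fun _ => Or.inl rfl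

theorem right_mem_valueSet (a b : G) : b ∈ valueSet G a b := fun _ => Or.inr rfl

theorem mul_self_eq_one (a : G) : a * a = 1 :=
  Subtype.ext (funext fun x => Int.units_mul_self (a.1 x))

theorem inv_eq_self (a : G) : a⁻¹ = a := inv_eq_of_mul_eq_one_left (mul_self_eq_one a)

/-- The exchange law for sums of four elements. -/
theorem IsSpaceOfOrderings.exchange (hG : IsSpaceOfOrderings G) {p q r s u v w : G}
    (hu : u ∈ valueSet G p q) (hv : v ∈ valueSet G r s) (hw : w ∈ valueSet G u v) :
    ∃ m n : G, m ∈ valueSet G p r ∧ n ∈ valueSet G q s ∧ w ∈ valueSet G m n := by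
  obtain ⟨d, hd, hd'⟩ := hG.assoc u r s w v hw hv
  obtain ⟨m, hm, hm'⟩ := hG.assoc r p q d u (valueSet_comm hd') hu
  obtain ⟨n, hn, hn'⟩ := hG.assoc s q m w d (valueSet_comm hd) (valueSet_comm hm)
  exact ⟨m, n, valueSet_comm hm', valueSet_comm hn', valueSet_comm hn⟩

/-! ### Preorders and the points containing them -/

/-- A preorder of `(X, G)`: a subgroup that is closed under value sets. -/
def IsPreorder (T : Subgroup G) : Prop :=
  ∀ ⦃a b : G⦄, a ∈ T → b ∈ T → ∀ c ∈ valueSet G a b, c ∈ T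

/-- The preorder generated by the preorder `T` and the element `g`. -/
def adjoin (hG : IsSpaceOfOrderings G) (T : Subgroup G) (hT : IsPreorder T) (g : G) :
    Subgroup G where
  carrier := {u | ∃ s ∈ T, ∃ t ∈ T, u ∈ valueSet G s (g * t)}
  one_mem' := ⟨1, T.one_mem, 1, T.one_mem, left_mem_valueSet _ _⟩
  inv_mem' {u} hu := by rwa [inv_eq_self]
  mul_mem' {u v} hu hv := by
    obtain ⟨s, hs, t, ht, hu⟩ := hu
    obtain ⟨s', hs', t', ht', hv⟩ := hv
    -- Expand `u * v` into the four terms `s's`, `s'gt`, `gt's`, `t't`; the exchange law regroups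
    -- them by whether the factor `g` occurs.
    have h1 := mul_mem_valueSet hv u
    have h2 := mul_mem_valueSet hu s'
    have h3 := valueSet_comm (mul_mem_valueSet hu (g * t'))
    rw [mul_comm s' u] at h2
    rw [mul_comm (g * t') u] at h3
    obtain ⟨m, n, hm, hn, h⟩ := hG.exchange h2 h3 h1
    have e1 : g * t' * (g * t) = t' * t := by
      rw [mul_mul_mul_comm, mul_self_eq_one, one_mul]
    rw [e1] at hm
    refine ⟨m, hT (T.mul_mem hs' hs) (T.mul_mem ht' ht) m hm, g * n, ?_, ?_⟩
    · have h4 := mul_mem_valueSet hn g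
      have e2 : g * (s' * (g * t)) = s' * t := by
        rw [mul_left_comm s', ← mul_assoc, mul_self_eq_one, one_mul]
      have e3 : g * (g * t' * s) = t' * s := by
        rw [mul_assoc g t', ← mul_assoc, mul_self_eq_one, one_mul]
      rw [e2, e3] at h4
      exact hT (T.mul_mem hs' ht) (T.mul_mem ht' hs) _ h4
    · rwa [← mul_assoc, mul_self_eq_one, one_mul]

section Adjoin

variable (hG : IsSpaceOfOrderings G) {T : Subgroup G} (hT : IsPreorder T)

theorem mem_adjoin {g u : G} :
    u ∈ adjoin hG T hT g ↔ ∃ s ∈ T, ∃ t ∈ T, u ∈ valueSet G s (g * t) := Iff.rfl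

theorem le_adjoin (g : G) : T ≤ adjoin hG T hT g := fun s hs =>
  ⟨s, hs, 1, T.one_mem, left_mem_valueSet _ _⟩

theorem self_mem_adjoin (g : G) : g ∈ adjoin hG T hT g :=
  ⟨1, T.one_mem, 1, T.one_mem, by rw [mul_one]; exact right_mem_valueSet _ _⟩

theorem isPreorder_adjoin (g : G) : IsPreorder (adjoin hG T hT g) := by
  rintro u v ⟨s, hs, t, ht, hu⟩ ⟨s', hs', t', ht', hv⟩ w hw
  obtain ⟨m, n, hm, hn, h⟩ := hG.exchange hu hv hw
  refine ⟨m, hT hs hs' m hm, g * n, ?_, ?_⟩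
  · have h4 := mul_mem_valueSet hn g
    rw [← mul_assoc, ← mul_assoc, mul_self_eq_one, one_mul, one_mul] at h4
    exact hT ht ht' _ h4
  · rwa [← mul_assoc, mul_self_eq_one, one_mul]

end Adjoin

/-- The constant function `-1` as an element of `G`. -/
def IsSpaceOfOrderings.negOne (hG : IsSpaceOfOrderings G) : G := ⟨-1, hG.neg_one_mem⟩

@[simp] theorem IsSpaceOfOrderings.negOne_apply (hG : IsSpaceOfOrderings G) (x : X) :
    hG.negOne.1 x = -1 := rfl

@[simp] theorem coe_mul_apply (a b : G) (x : X) : (a * b).1 x = a.1 x * b.1 x := rfl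

@[simp] theorem coe_one_apply (x : X) : (1 : G).1 x = 1 := rfl

theorem evalChar_apply (x : X) (a : G) : evalChar G x a = a.1 x := rfl

/-- Pointwise, -1 ∈ D(s, gt) says that `s` or `gt` is negative, which is the same as -gt ∈ D(1, s).
-/
theorem IsSpaceOfOrderings.mem_of_negOne_mem_adjoin (hG : IsSpaceOfOrderings G)
    {T : Subgroup G} (hT : IsPreorder T) {g : G} (h : hG.negOne ∈ adjoin hG T hT g) :
    hG.negOne * g ∈ T := by
  obtain ⟨s, hs, t, ht, h⟩ := h
  have h1 : hG.negOne * g * t ∈ valueSet G 1 s := by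
    intro x
    have := h x
    simp only [coe_mul_apply, IsSpaceOfOrderings.negOne_apply, coe_one_apply] at this ⊢
    generalize s.1 x = p at *
    generalize g.1 x = q at *
    generalize t.1 x = r at *
    revert p q r
    decide
  have h2 := T.mul_mem (hT T.one_mem hs _ h1) ht
  rwa [mul_assoc, mul_self_eq_one, mul_one] at h2

theorem isPreorder_sSup {c : Set (Subgroup G)} (hc : ∀ T ∈ c, IsPreorder T)
    (hch : IsChain (· ≤ ·) c) (hne : c.Nonempty) : IsPreorder (sSup c) := by
  intro a b ha hb d hd
  rw [Subgroup.mem_sSup_of_directedOn hne hch.directedOn] at *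
  obtain ⟨S, hS, ha⟩ := ha
  obtain ⟨S', hS', hb⟩ := hb
  rcases hch.total hS hS' with h | h
  · exact ⟨S', hS', hc _ hS' (h ha) hb d hd⟩
  · exact ⟨S, hS, hc _ hS ha (h hb) d hd⟩

theorem hom_eq_of_ker_le {A : Type*} [CommGroup A] {χ ψ : A →* ℤˣ} {e : A} (hχ : χ e = -1)
    (hψ : ψ e = -1) (h : ∀ a, χ a = 1 → ψ a = 1) : ψ = χ := by
  ext1 a
  rcases Int.units_eq_one_or (χ a) with h1 | h1
  · rw [h1, h a h1]
  · have h2 := h (e * a) (by rw [map_mul, hχ, h1]; decide)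
    rw [map_mul, hψ] at h2
    rw [h1]
    generalize ψ a = q at *
    revert q
    decide

/-- A proper preorder is contained in the kernel of a point. -/
theorem IsSpaceOfOrderings.exists_point_of_isPreorder (hG : IsSpaceOfOrderings G)
    {T : Subgroup G} (hT : IsPreorder T) (h : hG.negOne ∉ T) :
    ∃ x : X, ∀ t ∈ T, t.1 x = 1 := by
  obtain ⟨M, hTM, hM⟩ := zorn_le_nonempty₀ {T : Subgroup G | IsPreorder T ∧ hG.negOne ∉ T}
    (fun c hc hch S hS => ⟨sSup c, ⟨isPreorder_sSup (fun T hT => (hc hT).1) hch ⟨S, hS⟩, by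
      rw [Subgroup.mem_sSup_of_directedOn ⟨S, hS⟩ hch.directedOn]
      rintro ⟨S', hS', h'⟩
      exact (hc hS').2 h'⟩, fun T hT => le_sSup hT⟩) T ⟨hT, h⟩
  have hMp : IsPreorder M := hM.prop.1
  -- Maximality: adjoining `g ∉ M` must produce -1. Hence `M` has index 2 and is the kernel of a
  -- character to which axiom (1) applies.
  have hdich : ∀ g : G, g ∉ M → hG.negOne * g ∈ M := by
    intro g hg
    apply hG.mem_of_negOne_mem_adjoin hMp
    by_contra hcon
    exact hg (hM.le_of_ge ⟨isPreorder_adjoin hG hMp g, hcon⟩ (le_adjoin hG hMp g)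
      (self_mem_adjoin hG hMp g))
  have hneg : hG.negOne * hG.negOne = 1 := mul_self_eq_one _
  classical
  let χ : G →* ℤˣ :=
    { toFun := fun g => if g ∈ M then 1 else -1
      map_one' := if_pos M.one_mem
      map_mul' := by
        intro g k
        by_cases hg : g ∈ M
        · simp [hg, M.mul_mem_cancel_left hg]
        · by_cases hk : k ∈ M
          · simp [hg, hk, M.mul_mem_cancel_right hk]
          · have h1 := M.mul_mem (hdich g hg) (hdich k hk)
            rw [mul_mul_mul_comm, hneg, one_mul] at h1
            simp [hg, hk, h1] }
  have hχ : ∀ g, χ g = 1 ↔ g ∈ M := by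
    intro g
    change (if g ∈ M then (1 : ℤˣ) else -1) = 1 ↔ _
    by_cases hg : g ∈ M
    · simp [hg]
    · simp only [hg, if_false, iff_false]; decide
  obtain ⟨x, hx⟩ := hG.exists_point χ (if_neg hM.prop.2) (by
    intro a b ha hb d hd
    rw [MonoidHom.mem_ker, hχ] at *
    exact hMp ha hb d hd)
  refine ⟨x, fun t ht => ?_⟩
  rw [← evalChar_apply, hx, hχ]
  exact hTM ht

/-- A preorder is the intersection of the kernels of the points that contain it. -/
theorem IsSpaceOfOrderings.mem_of_forall_point (hG : IsSpaceOfOrderings G)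
    {T : Subgroup G} (hT : IsPreorder T) {e : G}
    (h : ∀ x : X, (∀ t ∈ T, t.1 x = 1) → e.1 x = 1) : e ∈ T := by
  by_contra he
  have h1 : hG.negOne ∉ adjoin hG T hT (hG.negOne * e) := by
    intro h1
    have h2 := hG.mem_of_negOne_mem_adjoin hT h1
    rw [← mul_assoc, mul_self_eq_one, one_mul] at h2
    exact he h2
  obtain ⟨x, hx⟩ := hG.exists_point_of_isPreorder (isPreorder_adjoin hG hT _) h1
  have h2 := hx _ (self_mem_adjoin hG hT _)
  rw [coe_mul_apply, h x (fun t ht => hx t (le_adjoin hG hT _ ht))] at h2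
  revert h2
  simp

/-! ### Subspaces cut out by preorders -/

/-- The subspace of all points at which the elements of `T` are positive. -/
def positivePoints (T : Subgroup G) : Set X := {x | ∀ t ∈ T, t.1 x = 1}

theorem apply_eq_one_of_mem_adjoin (hG : IsSpaceOfOrderings G) {T : Subgroup G}
    (hT : IsPreorder T) {g u : G} (h : u ∈ adjoin hG T hT g) {x : X}
    (hx : x ∈ positivePoints T) (hg : g.1 x = 1) : u.1 x = 1 := by
  obtain ⟨s, hs, t, ht, h⟩ := h
  rcases h x with h | h
  · rw [h, hx s hs]
  · rw [h, coe_mul_apply, hg, hx t ht, one_mul]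

theorem mem_adjoin_of_forall (hG : IsSpaceOfOrderings G) {T : Subgroup G}
    (hT : IsPreorder T) {g u : G} (h : ∀ x ∈ positivePoints T, g.1 x = 1 → u.1 x = 1) :
    u ∈ adjoin hG T hT g :=
  hG.mem_of_forall_point (isPreorder_adjoin hG hT g) fun x hx =>
    h x (fun t ht => hx t (le_adjoin hG hT g ht)) (hx g (self_mem_adjoin hG hT g))

/-- On a subspace, value sets are obtained by varying the arguments outside of the subspace. -/
theorem exists_mem_valueSet_of_forall (hG : IsSpaceOfOrderings G) {T : Subgroup G}
    (hT : IsPreorder T) {p q e : G}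
    (h : ∀ x ∈ positivePoints T, e.1 x = p.1 x ∨ e.1 x = q.1 x) :
    ∃ s ∈ T, ∃ t ∈ T, e ∈ valueSet G (p * s) (q * t) := by
  have h1 : p * e ∈ adjoin hG T hT (p * q) := by
    refine mem_adjoin_of_forall hG hT fun x hx => ?_
    have := h x hx
    simp only [coe_mul_apply]
    generalize p.1 x = p at *
    generalize q.1 x = q at *
    generalize e.1 x = e at *
    revert p q e
    decide
  obtain ⟨s, hs, t, ht, h1⟩ := h1
  have h2 := mul_mem_valueSet h1 p
  rw [← mul_assoc, ← mul_assoc, ← mul_assoc, mul_self_eq_one, one_mul, one_mul] at h2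
  exact ⟨s, hs, t, ht, h2⟩

/-- The associativity axiom on a subspace. -/
theorem assoc_positivePoints (hG : IsSpaceOfOrderings G) {T : Subgroup G}
    (hT : IsPreorder T) {a₁ a₂ a₃ b c : G}
    (hb : ∀ x ∈ positivePoints T, b.1 x = a₁.1 x ∨ b.1 x = c.1 x)
    (hc : ∀ x ∈ positivePoints T, c.1 x = a₂.1 x ∨ c.1 x = a₃.1 x) :
    ∃ d : G, ∀ x ∈ positivePoints T,
      (b.1 x = d.1 x ∨ b.1 x = a₃.1 x) ∧ (d.1 x = a₁.1 x ∨ d.1 x = a₂.1 x) := by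
  obtain ⟨s, hs, t, ht, h1⟩ := exists_mem_valueSet_of_forall hG hT hb
  obtain ⟨s', hs', t', ht', h2⟩ := exists_mem_valueSet_of_forall hG hT hc
  have h3 := mul_mem_valueSet h2 t
  rw [mul_comm t c] at h3
  obtain ⟨d, hd, hd'⟩ := hG.assoc _ _ _ _ _ h1 h3
  refine ⟨d, fun x hx => ⟨?_, ?_⟩⟩
  · have := hd x
    simpa [hx t ht, hx t' ht'] using this
  · have := hd' x
    simpa [hx s hs, hx t ht, hx s' hs'] using this

/-! ### Four-element fans -/

/-- Characters that are positive on the common kernel of three characters. -/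
theorem hom_eq_of_three_kers {A : Type*} [CommGroup A] {χ x₁ x₂ x₃ : A →* ℤˣ} {e : A}
    (hχ : χ e = -1) (h₁ : x₁ e = -1) (h₂ : x₂ e = -1) (h₃ : x₃ e = -1)
    (h : ∀ a, x₁ a = 1 → x₂ a = 1 → x₃ a = 1 → χ a = 1) :
    χ = x₁ ∨ χ = x₂ ∨ χ = x₃ ∨ χ = x₁ * x₂ * x₃ := by
  -- A subgroup is not the union of two proper subgroups: on `K`, `ψ` is trivial or equal to `y`.
  -- Peeling off the three characters in turn writes `χ` as a product of some of them; evaluation at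
  -- `e` leaves an odd number.
  have key : ∀ (K : Subgroup A) (ψ y : A →* ℤˣ), (∀ a ∈ K, y a = 1 → ψ a = 1) →
      (∀ a ∈ K, ψ a = 1) ∨ ∀ a ∈ K, ψ a = y a := by
    intro K ψ y hK
    by_contra! hcon
    obtain ⟨⟨a, ha, ha'⟩, b, hb, hb'⟩ := hcon
    have h1 := hK a ha
    have h2 := hK b hb
    have h3 := hK _ (K.mul_mem ha hb)
    rw [map_mul, map_mul] at h3
    generalize ψ a = p at *
    generalize ψ b = q at *
    generalize y a = r at *
    generalize y b = s at *
    revert p q r s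
    decide
  have step : ∀ (K : Subgroup A) (ψ y : A →* ℤˣ), (∀ a ∈ K, y a = 1 → ψ a = 1) →
      ∃ z : A →* ℤˣ, (z = 1 ∨ z = y) ∧ ∀ a ∈ K, (ψ * z) a = 1 := by
    intro K ψ y hK
    rcases key K ψ y hK with h | h
    · exact ⟨1, Or.inl rfl, fun a ha => by simp [h a ha]⟩
    · exact ⟨y, Or.inr rfl, fun a ha => by simp [h a ha, Int.units_mul_self]⟩
  obtain ⟨z₃, hz₃, h⟩ := step (x₁.ker ⊓ x₂.ker) χ x₃
    (fun a ha h3 => h a ha.1 ha.2 h3)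
  obtain ⟨z₂, hz₂, h⟩ := step x₁.ker (χ * z₃) x₂ (fun a ha h2 => h a ⟨ha, h2⟩)
  obtain ⟨z₁, hz₁, h⟩ := step ⊤ (χ * z₃ * z₂) x₁ (fun a _ h1 => h a h1)
  have h4 : χ = z₁ * z₂ * z₃ := by
    ext1 a
    have := h a trivial
    simp only [MonoidHom.mul_apply] at this ⊢
    generalize χ a = p at *
    generalize z₁ a = q at *
    generalize z₂ a = r at *
    generalize z₃ a = s at *
    revert p q r s
    decide
  have h5 := h e trivial
  rcases hz₁ with rfl | rfl <;> rcases hz₂ with rfl | rfl <;> rcases hz₃ with rfl | rfl <;>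
    simp_all

theorem IsSpaceOfOrderings.evalChar_injective (hG : IsSpaceOfOrderings G) :
    Function.Injective (evalChar G) := by
  intro x y h
  by_contra hxy
  obtain ⟨a, ha, hne⟩ := hG.separates x y hxy
  exact hne (DFunLike.congr_fun h ⟨a, ha⟩)

/-- Four points with product one form a fan. -/
theorem IsSpaceOfOrderings.isFanIn_of_prod_eq_one (hG : IsSpaceOfOrderings G)
    {x₁ x₂ x₃ x₄ : X}
    (h : evalChar G x₄ = evalChar G x₁ * evalChar G x₂ * evalChar G x₃) :
    IsFanIn G {x₁, x₂, x₃, x₄} := by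
  -- Used twice: for points, to see that the set is a subspace, and for characters of the restricted
  -- group, to see that it is a fan.
  have key : ∀ χ : G →* ℤˣ, χ hG.negOne = -1 →
      (∀ a : G, (∀ x ∈ ({x₁, x₂, x₃, x₄} : Set X), a.1 x = 1) → χ a = 1) →
      ∃ x ∈ ({x₁, x₂, x₃, x₄} : Set X), evalChar G x = χ := by
    intro χ hχ hker
    rcases hom_eq_of_three_kers (x₁ := evalChar G x₁) (x₂ := evalChar G x₂)
      (x₃ := evalChar G x₃) hχ rfl rfl rfl (by
        intro a h1 h2 h3
        apply hker
        have h4 : evalChar G x₄ a = 1 := by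
          rw [h, MonoidHom.mul_apply, MonoidHom.mul_apply, h1, h2, h3]; rfl
        rintro x (rfl | rfl | rfl | rfl)
        exacts [h1, h2, h3, h4]) with e | e | e | e
    · exact ⟨x₁, by simp, e.symm⟩
    · exact ⟨x₂, by simp, e.symm⟩
    · exact ⟨x₃, by simp, e.symm⟩
    · exact ⟨x₄, by simp, by rw [h, e]⟩
  refine ⟨⟨{a | ∀ x ∈ ({x₁, x₂, x₃, x₄} : Set X), a.1 x = 1}, ?_⟩, ?_⟩
  · ext x
    simp only [Set.mem_iInter]
    constructor
    · intro hx a ha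
      exact ha x hx
    · intro hx
      obtain ⟨y, hy, hyx⟩ := key (evalChar G x) rfl hx
      rwa [← hG.evalChar_injective hyx]
  · have hm : (-1 : (({x₁, x₂, x₃, x₄} : Set X)) → ℤˣ) ∈ restrictGroup G {x₁, x₂, x₃, x₄} :=
      ⟨-1, hG.neg_one_mem, rfl⟩
    refine ⟨⟨x₁, by simp⟩, hm, fun χ hχ => ?_⟩
    let r : G →* restrictGroup G {x₁, x₂, x₃, x₄} :=
      (restrictHom ({x₁, x₂, x₃, x₄} : Set X)).subgroupMap G
    have hr : Function.Surjective r := MonoidHom.subgroupMap_surjective _ G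
    obtain ⟨x, hx, hxχ⟩ := key (χ.comp r) hχ (by
      intro a ha
      have : r a = 1 := Subtype.ext (funext fun x => ha x.1 x.2)
      rw [MonoidHom.comp_apply, this, map_one])
    refine ⟨⟨x, hx⟩, ?_, ?_⟩
    · ext1 b
      obtain ⟨a, rfl⟩ := hr b
      exact DFunLike.congr_fun hxχ a
    · rintro ⟨y, hy⟩ hyχ
      apply Subtype.ext
      apply hG.evalChar_injective
      rw [hxχ]
      ext1 a
      exact DFunLike.congr_fun hyχ (r a)

theorem IsSpaceOfOrderings.evalChar_ne_of_isSAP (hG : IsSpaceOfOrderings G) (hSAP : IsSAP G)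
    {x₁ x₂ x₃ : X} (h₁₂ : x₁ ≠ x₂) (h₁₃ : x₁ ≠ x₃) (h₂₃ : x₂ ≠ x₃) (x₄ : X) :
    evalChar G x₄ ≠ evalChar G x₁ * evalChar G x₂ * evalChar G x₃ := by
  intro h
  have hval : ∀ a : G, a.1 x₄ = a.1 x₁ * a.1 x₂ * a.1 x₃ := fun a => DFunLike.congr_fun h a
  have hne : ∀ y z w : X, y ≠ z → (∀ a : G, a.1 w = a.1 w * a.1 y * a.1 z) → False := by
    intro y z w hyz hw
    apply hyz
    apply hG.evalChar_injective
    ext1 a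
    have := hw a
    rw [evalChar_apply, evalChar_apply]
    generalize a.1 w = p at *
    generalize a.1 y = q at *
    generalize a.1 z = r at *
    revert p q r
    decide
  have h₁₄ : x₁ ≠ x₄ := by
    rintro rfl
    exact hne x₂ x₃ x₁ h₂₃ hval
  have h₂₄ : x₂ ≠ x₄ := by
    rintro rfl
    exact hne x₁ x₃ x₂ h₁₃ fun a => (hval a).trans (by rw [mul_comm (a.1 x₁)])
  have h₃₄ : x₃ ≠ x₄ := by
    rintro rfl
    exact hne x₁ x₂ x₃ h₁₂ fun a => (hval a).trans (by rw [mul_assoc, mul_comm, mul_assoc,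
      mul_comm (a.1 x₂), mul_assoc])
  have hcard : ({x₁, x₂, x₃, x₄} : Set X).encard = 2 ^ 2 := by
    rw [Set.encard_insert_of_notMem (by simp [*]), Set.encard_insert_of_notMem (by simp [*]),
      Set.encard_pair h₃₄]
    norm_num
  have h2 : (2 : ℕ∞) ≤ stabilityIndex G :=
    le_iSup₂_of_le (f := fun (n : ℕ) (_ : ∃ V : Set X, IsFanIn G V ∧ V.encard = 2 ^ n) =>
      (n : ℕ∞)) 2 ⟨_, hG.isFanIn_of_prod_eq_one h, hcard⟩ le_rfl
  rw [hSAP] at h2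
  exact absurd h2 (by norm_num)

theorem units_eq_of_mul_eq_one {u v : ℤˣ} (h : u * v = 1) : u = v := by
  revert u v
  decide

/-! ### Gluing in SAP spaces -/

/-- A function that agrees with elements of `G` on the complements of the three pieces of a
partition of a subspace agrees with an element of `G` on the whole subspace. -/
theorem exists_eq_on_positivePoints (hG : IsSpaceOfOrderings G) {T : Subgroup G}
    (hT : IsPreorder T) (f : X → ℤˣ) {w₁ w₂ w₃ g₁ g₂ g₃ : G}
    (hw : ∀ x ∈ positivePoints T, (w₁.1 x = -1 ∧ w₂.1 x = 1 ∧ w₃.1 x = 1) ∨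
      (w₁.1 x = 1 ∧ w₂.1 x = -1 ∧ w₃.1 x = 1) ∨ (w₁.1 x = 1 ∧ w₂.1 x = 1 ∧ w₃.1 x = -1))
    (h₁ : ∀ x ∈ positivePoints T, w₁.1 x = 1 → g₁.1 x = f x)
    (h₂ : ∀ x ∈ positivePoints T, w₂.1 x = 1 → g₂.1 x = f x)
    (h₃ : ∀ x ∈ positivePoints T, w₃.1 x = 1 → g₃.1 x = f x) :
    ∃ g : G, ∀ x ∈ positivePoints T, g.1 x = f x := by
  -- The entries are chosen so that `d` must equal `w₁ * w₂ * g₃ * f` on every piece: on the first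
  -- two because `b = -1` differs from `a₃ = 1`, on the third because `a₁ = a₂`.
  obtain ⟨d, hd⟩ := assoc_positivePoints hG hT (a₁ := w₁ * g₂ * g₃) (a₂ := w₁ * w₂ * g₂ * g₃)
    (a₃ := 1) (b := w₁ * w₂) (c := g₁ * g₂ * w₂)
    (by
      intro x hx
      simp only [coe_mul_apply]
      rcases hw x hx with ⟨e1, e2, e3⟩ | ⟨e1, e2, e3⟩ | ⟨e1, e2, e3⟩
      · rw [e1, e2, h₂ x hx e2, h₃ x hx e3]
        generalize f x = p
        generalize g₁.1 x = q
        revert p q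
        decide
      · rw [e1, e2, h₁ x hx e1, h₃ x hx e3]
        generalize f x = p
        generalize g₂.1 x = q
        revert p q
        decide
      · rw [e1, e2, h₁ x hx e1, h₂ x hx e2]
        generalize f x = p
        generalize g₃.1 x = q
        revert p q
        decide)
    (by
      intro x hx
      simp only [coe_mul_apply, coe_one_apply]
      rcases hw x hx with ⟨e1, e2, e3⟩ | ⟨e1, e2, e3⟩ | ⟨e1, e2, e3⟩
      · rw [e1, e2, h₂ x hx e2, h₃ x hx e3]
        generalize f x = p
        generalize g₁.1 x = q
        revert p q
        decide
      · rw [e1, e2, h₁ x hx e1, h₃ x hx e3]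
        generalize f x = p
        generalize g₂.1 x = q
        revert p q
        decide
      · rw [e1, e2, h₁ x hx e1, h₂ x hx e2]
        generalize f x = p
        generalize g₃.1 x = q
        revert p q
        decide)
  refine ⟨d * g₃ * w₁ * w₂, fun x hx => ?_⟩
  obtain ⟨hd1, hd2⟩ := hd x hx
  simp only [coe_mul_apply, coe_one_apply] at hd1 hd2 ⊢
  rcases hw x hx with ⟨e1, e2, e3⟩ | ⟨e1, e2, e3⟩ | ⟨e1, e2, e3⟩
  · rw [e1, e2, h₃ x hx e3]
    rw [e1, e2] at hd1
    generalize f x = p at *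
    generalize d.1 x = q at *
    clear * - hd1
    revert p q
    decide
  · rw [e1, e2, h₃ x hx e3]
    rw [e1, e2] at hd1
    generalize f x = p at *
    generalize d.1 x = q at *
    clear * - hd1
    revert p q
    decide
  · rw [e1, e2]
    rw [e1, e2, h₂ x hx e2] at hd2
    generalize f x = p at *
    generalize d.1 x = q at *
    generalize g₃.1 x = r at *
    clear * - hd2
    revert p q r
    decide

/-- If no four distinct points have product one, then a function that does not belong to `G` on
a subspace already does not belong to `G` on the intersection with some proper Harrison set. -/
theorem exists_eq_on_positivePoints_of_isSAP (hG : IsSpaceOfOrderings G) (hSAP : IsSAP G)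
    {T : Subgroup G} (hT : IsPreorder T) (f : X → ℤˣ)
    (hf : ∀ u ∉ T, ∃ g : G, ∀ x ∈ positivePoints T, u.1 x = 1 → g.1 x = f x) :
    ∃ g : G, ∀ x ∈ positivePoints T, g.1 x = f x := by
  by_contra hcon
  -- Otherwise `u`, `u * v` and `-v` define a partition into three nonempty pieces; by `hf`, `f`
  -- comes from `G` off each piece, so it would come from `G` on the whole subspace.
  have hD : ∀ u v : G, (∀ x ∈ positivePoints T, u.1 x = 1 ∨ u.1 x = v.1 x) →
      (∀ x ∈ positivePoints T, u.1 x = 1) ∨ (∀ x ∈ positivePoints T, u.1 x = v.1 x) ∨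
      (∀ x ∈ positivePoints T, v.1 x = -1) := by
    intro u v huv
    by_contra! hne
    obtain ⟨⟨x₁, hx₁, h₁⟩, ⟨x₂, hx₂, h₂⟩, x₃, hx₃, h₃⟩ := hne
    obtain ⟨g₁, hg₁⟩ := hf u (fun h => h₁ (hx₁ u h))
    obtain ⟨g₂, hg₂⟩ := hf (u * v) (fun h => by
      have := hx₂ _ h
      exact h₂ (units_eq_of_mul_eq_one this))
    obtain ⟨g₃, hg₃⟩ := hf (hG.negOne * v) (fun h => by
      have := hx₃ _ h
      rw [coe_mul_apply, hG.negOne_apply] at this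
      generalize v.1 x₃ = q at *
      revert q
      decide)
    refine hcon (exists_eq_on_positivePoints hG hT f ?_ hg₁ hg₂ hg₃)
    intro x hx
    have := huv x hx
    simp only [coe_mul_apply, hG.negOne_apply]
    generalize u.1 x = p at *
    generalize v.1 x = q at *
    revert p q
    decide
  by_cases h3 : ∃ x₁ ∈ positivePoints T, ∃ x₂ ∈ positivePoints T, ∃ x₃ ∈ positivePoints T,
      x₁ ≠ x₂ ∧ x₁ ≠ x₃ ∧ x₂ ≠ x₃
  · obtain ⟨x₁, hx₁, x₂, hx₂, x₃, hx₃, h12, h13, h23⟩ := h3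
    -- By `hD`, an element of D(p, q) agrees with `p` or `q` on the subspace unless `q = -p` there.
    -- The last case is impossible: a product of three points changes sign under negation.
    obtain ⟨x₄, hx₄⟩ := hG.exists_point (evalChar G x₁ * evalChar G x₂ * evalChar G x₃)
      (by simp only [MonoidHom.mul_apply, evalChar_apply]; simp) (by
        intro p q hp hq d hd
        simp only [MonoidHom.mem_ker, MonoidHom.mul_apply, evalChar_apply] at hp hq ⊢
        rcases hD (p * d) (p * q) (by
          intro x _
          rcases hd x with e | e
          · left; rw [coe_mul_apply, e, Int.units_mul_self]
          · right; rw [coe_mul_apply, coe_mul_apply, e]) with h | h | h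
        · have e : ∀ x ∈ positivePoints T, d.1 x = p.1 x := by
            intro x hx
            have := h x hx
            exact (units_eq_of_mul_eq_one this).symm
          rw [e _ hx₁, e _ hx₂, e _ hx₃, hp]
        · have e : ∀ x ∈ positivePoints T, d.1 x = q.1 x := fun x hx =>
            mul_left_cancel (h x hx)
          rw [e _ hx₁, e _ hx₂, e _ hx₃, hq]
        · exfalso
          have e1 := h _ hx₁
          have e2 := h _ hx₂
          have e3 := h _ hx₃
          have e4 : (p * q).1 x₁ * (p * q).1 x₂ * (p * q).1 x₃ = 1 := by
            simp only [coe_mul_apply]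
            calc _ = (p.1 x₁ * p.1 x₂ * p.1 x₃) * (q.1 x₁ * q.1 x₂ * q.1 x₃) := by
                  simp only [mul_assoc, mul_left_comm]
              _ = 1 := by rw [hp, hq]; rfl
          rw [e1, e2, e3] at e4
          revert e4
          decide)
    exact hG.evalChar_ne_of_isSAP hSAP h12 h13 h23 x₄ hx₄
  · push Not at h3
    apply hcon
    have hconst : ∀ ε : ℤˣ, ∃ g : G, ∀ x, g.1 x = ε := by
      intro ε
      rcases Int.units_eq_one_or ε with rfl | rfl
      · exact ⟨1, fun _ => rfl⟩
      · exact ⟨hG.negOne, fun _ => rfl⟩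
    by_cases h1 : ∃ x ∈ positivePoints T, ∃ y ∈ positivePoints T, f x ≠ f y
    · obtain ⟨x, hx, y, hy, hxy⟩ := h1
      have hxy' : x ≠ y := fun h => hxy (congrArg f h)
      obtain ⟨a, ha, hne⟩ := hG.separates x y hxy'
      obtain ⟨g, hg⟩ := hconst (f x * a x)
      refine ⟨g * ⟨a, ha⟩, fun z hz => ?_⟩
      have hz' : z = x ∨ z = y := by
        by_contra! h
        exact h.2 (h3 x hx y hy z hz hxy' (Ne.symm h.1)).symm
      rw [coe_mul_apply, hg]
      rcases hz' with rfl | rfl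
      · rw [mul_assoc, Int.units_mul_self, mul_one]
      · change f x * a x * a z = f z
        generalize f x = p at *
        generalize f z = q at *
        generalize a x = r at *
        generalize a z = s at *
        clear * - hxy hne
        revert p q r s
        decide
    · push Not at h1
      by_cases hne : ∃ x, x ∈ positivePoints T
      · obtain ⟨x, hx⟩ := hne
        obtain ⟨g, hg⟩ := hconst (f x)
        exact ⟨g, fun y hy => (hg y).trans (h1 x hx y hy)⟩
      · exact ⟨1, fun y hy => (hne ⟨y, hy⟩).elim⟩

/-- In an SAP space, `G` contains all functions obtained by gluing along Harrison sets. -/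
theorem IsSpaceOfOrderings.exists_glue (hG : IsSpaceOfOrderings G) (hSAP : IsSAP G)
    (a b : G) : ∃ g : G, ∀ x, g.1 x = if a.1 x = 1 then 1 else b.1 x := by
  classical
  set f : X → ℤˣ := fun x => if a.1 x = 1 then 1 else b.1 x with hf
  -- The subspaces where `f` does not come from `G`, expressed by membership in preorders. Each
  -- membership involves finitely many elements of `T`, so badness passes to unions of chains.
  let bad : Set (Subgroup G) := {T | ∃ hT : IsPreorder T, ∀ g : G,
    g ∈ adjoin hG T hT a → g * b ∉ adjoin hG T hT (hG.negOne * a)}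
  have hneg : ∀ x, (hG.negOne * a).1 x = 1 ↔ a.1 x ≠ 1 := by
    intro x
    rw [coe_mul_apply, hG.negOne_apply]
    generalize a.1 x = p
    revert p
    decide
  have hgood : ∀ T : Subgroup G, IsPreorder T →
      ((∃ g : G, ∀ x ∈ positivePoints T, g.1 x = f x) ↔ T ∉ bad) := by
    intro T hT
    constructor
    · rintro ⟨g, hg⟩ ⟨_, hbad⟩
      refine hbad g (mem_adjoin_of_forall hG hT fun x hx hax => ?_)
        (mem_adjoin_of_forall hG hT fun x hx hax => ?_)
      · rw [hg x hx, hf]; exact if_pos hax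
      · have hax' := (hneg x).1 hax
        rw [coe_mul_apply, hg x hx, hf]
        simp only [hax', if_false]
        exact Int.units_mul_self _
    · intro hbad
      have : ∃ g : G, g ∈ adjoin hG T hT a ∧ g * b ∈ adjoin hG T hT (hG.negOne * a) := by
        by_contra! h
        exact hbad ⟨hT, h⟩
      obtain ⟨g, h1, h2⟩ := this
      refine ⟨g, fun x hx => ?_⟩
      by_cases hax : a.1 x = 1
      · rw [apply_eq_one_of_mem_adjoin hG hT h1 hx hax, hf]; exact (if_pos hax).symm
      · have := apply_eq_one_of_mem_adjoin hG hT h2 hx ((hneg x).2 hax)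
        rw [units_eq_of_mul_eq_one this, hf]; exact (if_neg hax).symm
  have hbot : IsPreorder (⊥ : Subgroup G) := by
    intro p q hp hq d hd
    rw [Subgroup.mem_bot] at *
    subst hp hq
    exact Subtype.ext (funext fun x => (hd x).elim id id)
  suffices h : (⊥ : Subgroup G) ∉ bad by
    obtain ⟨g, hg⟩ := (hgood ⊥ hbot).2 h
    refine ⟨g, fun x => hg x ?_⟩
    intro t ht
    rw [Subgroup.mem_bot.1 ht]; rfl
  intro hbad
  obtain ⟨M, -, hM⟩ := zorn_le_nonempty₀ bad (by
    intro c hc hch S hS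
    have hP := isPreorder_sSup (fun T hT => (hc hT).1) hch ⟨S, hS⟩
    refine ⟨sSup c, ⟨hP, ?_⟩, fun T hT => le_sSup hT⟩
    rintro g ⟨s, hs, t, ht, h1⟩ ⟨s', hs', t', ht', h2⟩
    have hdir := hch.directedOn
    have hne : c.Nonempty := ⟨S, hS⟩
    rw [Subgroup.mem_sSup_of_directedOn hne hdir] at hs ht hs' ht'
    obtain ⟨S₁, hS₁, hs⟩ := hs
    obtain ⟨S₂, hS₂, ht⟩ := ht
    obtain ⟨S₃, hS₃, hs'⟩ := hs'
    obtain ⟨S₄, hS₄, ht'⟩ := ht'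
    obtain ⟨S₅, hS₅, h15, h25⟩ := hdir _ hS₁ _ hS₂
    obtain ⟨S₆, hS₆, h36, h46⟩ := hdir _ hS₃ _ hS₄
    obtain ⟨S₇, hS₇, h57, h67⟩ := hdir _ hS₅ _ hS₆
    obtain ⟨hp, hb⟩ := hc hS₇
    exact hb g ⟨s, h57 (h15 hs), t, h57 (h25 ht), h1⟩
      ⟨s', h67 (h36 hs'), t', h67 (h46 ht'), h2⟩) ⊥ hbad
  obtain ⟨hMp, -⟩ := hM.prop
  refine (hgood M hMp).1 (exists_eq_on_positivePoints_of_isSAP hG hSAP hMp f ?_) hM.prop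
  intro u hu
  have hP := isPreorder_adjoin hG hMp u
  obtain ⟨g, hg⟩ := (hgood _ hP).2 (fun h => hu
    (hM.le_of_ge h (le_adjoin hG hMp u) (self_mem_adjoin hG hMp u)))
  exact ⟨g, fun x hx hux => hg x fun t ht => apply_eq_one_of_mem_adjoin hG hMp ht hx hux⟩

/-! ### The axioms for the quotient structure -/

/-- The quotient structure is a space of orderings as soon as both axioms hold for `G₀`. -/
theorem IsSpaceOfOrderings.isQuotientSpace (hG : IsSpaceOfOrderings G) {G₀ : Subgroup G}
    (hneg : hG.negOne ∈ G₀)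
    (h₁ : ∀ χ : G₀ →* ℤˣ, χ ⟨hG.negOne, hneg⟩ = -1 →
      (∀ a b c : G₀, χ a = 1 → χ b = 1 → c.1 ∈ valueSet G a.1 b.1 → χ c = 1) →
      ∃ x : X, (evalChar G x).comp G₀.subtype = χ)
    (h₂ : ∀ a₁ a₂ a₃ b c : G, a₁ ∈ G₀ → a₂ ∈ G₀ → a₃ ∈ G₀ → b ∈ G₀ → c ∈ G₀ →
      b ∈ valueSet G a₁ c → c ∈ valueSet G a₂ a₃ →
      ∃ d ∈ G₀, b ∈ valueSet G d a₃ ∧ d ∈ valueSet G a₁ a₂) :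
    IsQuotientSpace G G₀ := by
  let q : G₀ →* quotientStructure G G₀ := (quotientHom G G₀).rangeRestrict
  have hq : Function.Surjective q := MonoidHom.rangeRestrict_surjective _
  have hD : ∀ a b c : G₀, q c ∈ valueSet (quotientStructure G G₀) (q a) (q b) ↔
      c.1 ∈ valueSet G a.1 b.1 := by
    intro a b c
    constructor
    · exact fun h x => h ⟨_, x, rfl⟩
    · rintro h ⟨_, x, rfl⟩
      exact h x
  have hq1 : quotientHom G G₀ ⟨hG.negOne, hneg⟩ = -1 := by
    funext ⟨_, x, hx⟩
    subst hx
    rfl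
  refine ⟨⟨⟨_, hG.nonempty.some, rfl⟩⟩, ⟨_, hq1⟩, ?_, ?_, ?_⟩
  · intro σ τ hne
    by_contra! hcon
    exact hne (Subtype.ext (MonoidHom.ext fun a => hcon _ ⟨a, rfl⟩))
  · intro χ hχ hker
    obtain ⟨x, hx⟩ := h₁ (χ.comp q)
      (by rw [← hχ]; exact congrArg χ (Subtype.ext hq1))
      (fun a b c ha hb hc => hker (q a) (q b) ha hb (q c) ((hD a b c).2 hc))
    refine ⟨⟨_, x, rfl⟩, ?_⟩
    ext1 a
    obtain ⟨a, rfl⟩ := hq a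
    exact DFunLike.congr_fun hx a
  · intro a₁ a₂ a₃ b c hb hc
    obtain ⟨a₁, rfl⟩ := hq a₁
    obtain ⟨a₂, rfl⟩ := hq a₂
    obtain ⟨a₃, rfl⟩ := hq a₃
    obtain ⟨b, rfl⟩ := hq b
    obtain ⟨c, rfl⟩ := hq c
    obtain ⟨d, hd, h, h'⟩ := h₂ _ _ _ _ _ a₁.2 a₂.2 a₃.2 b.2 c.2 ((hD _ _ _).1 hb)
      ((hD _ _ _).1 hc)
    exact ⟨q ⟨d, hd⟩, (hD ⟨d, hd⟩ _ _).2 h, (hD _ _ ⟨d, hd⟩).2 h'⟩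

/-- Infima: the Harrison set of `g` is the intersection of those of `a` and `b`. -/
theorem IsSpaceOfOrderings.exists_glue_neg_one (hG : IsSpaceOfOrderings G) (hSAP : IsSAP G)
    (a b : G) : ∃ g : G, ∀ x, g.1 x = if a.1 x = 1 then b.1 x else -1 := by
  obtain ⟨g, hg⟩ := hG.exists_glue hSAP a (hG.negOne * b)
  refine ⟨b * g, fun x => ?_⟩
  rw [coe_mul_apply, hg, coe_mul_apply, hG.negOne_apply]
  generalize a.1 x = p
  generalize b.1 x = q
  revert p q
  decide

/-- A character of `G₀` with kernel closed under value sets is the restriction of a point, if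
`G₀` contains the infima of its elements with a fixed element of the kernel. -/
theorem IsSpaceOfOrderings.exists_comp_eq (hG : IsSpaceOfOrderings G) (hSAP : IsSAP G)
    {G₀ : Subgroup G} (hneg : hG.negOne ∈ G₀) {χ : G₀ →* ℤˣ}
    (hχ : χ ⟨hG.negOne, hneg⟩ = -1)
    (hker : ∀ a b c : G₀, χ a = 1 → χ b = 1 → c.1 ∈ valueSet G a.1 b.1 → χ c = 1)
    {m : G₀} (hm : χ m = 1)
    (hmin : ∀ p ∈ G₀, ∀ q ∈ G₀, ∀ r : G,
      (∀ x, r.1 x = if m.1.1 x = 1 then (if p.1 x = 1 then q.1 x else -1) else -1) →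
      r ∈ G₀) :
    ∃ x : X, (evalChar G x).comp G₀.subtype = χ := by
  -- The lower bound is the infimum of `m`, `p`, `q`: including `m` keeps it in `G₀`, and taking
  -- infima one at a time, each in a value set, keeps it in the kernel.
  have key : ∀ p q : G₀, χ p = 1 → χ q = 1 → ∃ r : G₀, χ r = 1 ∧
      ∀ x, r.1.1 x = 1 → p.1.1 x = 1 ∧ q.1.1 x = 1 := by
    intro p q hp hq
    obtain ⟨n, hn⟩ := hG.exists_glue_neg_one hSAP m.1 p.1
    obtain ⟨r, hr⟩ := hG.exists_glue_neg_one hSAP n q.1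
    have hnG : n ∈ G₀ := hmin p.1 p.2 p.1 p.2 n (by
      intro x
      rw [hn]
      generalize m.1.1 x = a
      generalize p.1.1 x = b
      revert a b
      decide)
    have hrG : r ∈ G₀ := hmin p.1 p.2 q.1 q.2 r (by
      intro x
      rw [hr, hn]
      generalize m.1.1 x = a
      generalize p.1.1 x = b
      generalize q.1.1 x = c
      revert a b c
      decide)
    have hn1 : χ ⟨n, hnG⟩ = 1 := hker m p _ hm hp (by
      intro x
      rw [hn]
      generalize m.1.1 x = a
      generalize p.1.1 x = b
      revert a b
      decide)
    have hr1 : χ ⟨r, hrG⟩ = 1 := hker ⟨n, hnG⟩ q _ hn1 hq (by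
      intro x
      rw [hr]
      generalize n.1 x = a
      generalize q.1.1 x = b
      revert a b
      decide)
    refine ⟨⟨r, hrG⟩, hr1, fun x hx => ?_⟩
    have h1 := hr x
    rw [hn] at h1
    change r.1 x = 1 at hx
    rw [hx] at h1
    clear * - h1
    generalize m.1.1 x = a at *
    generalize p.1.1 x = b at *
    generalize q.1.1 x = c at *
    revert a b c
    decide
  -- The elements of `G` lying above some element of the kernel of `χ`, a proper preorder of `G`.
  let P : Subgroup G :=
    { carrier := {g | ∃ p : G₀, χ p = 1 ∧ ∀ x, p.1.1 x = 1 → g.1 x = 1}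
      one_mem' := ⟨1, map_one χ, fun _ _ => rfl⟩
      inv_mem' := fun {g} h => by rwa [inv_eq_self]
      mul_mem' := by
        rintro g k ⟨p, hp, hg⟩ ⟨q, hq, hk⟩
        obtain ⟨r, hr, h⟩ := key p q hp hq
        exact ⟨r, hr, fun x hx => by
          rw [coe_mul_apply, hg x (h x hx).1, hk x (h x hx).2, one_mul]⟩ }
  have hP : IsPreorder P := by
    rintro g k ⟨p, hp, hg⟩ ⟨q, hq, hk⟩ c hc
    obtain ⟨r, hr, h⟩ := key p q hp hq
    refine ⟨r, hr, fun x hx => ?_⟩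
    rcases hc x with e | e
    · rw [e, hg x (h x hx).1]
    · rw [e, hk x (h x hx).2]
  have hP1 : hG.negOne ∉ P := by
    rintro ⟨p, hp, h⟩
    have e : p = ⟨hG.negOne, hneg⟩ := by
      apply Subtype.ext
      apply Subtype.ext
      funext x
      have := h x
      change p.1.1 x = -1
      rw [hG.negOne_apply] at this
      generalize p.1.1 x = a at *
      clear * - this
      revert a
      decide
    rw [e, hχ] at hp
    revert hp
    decide
  obtain ⟨x, hx⟩ := hG.exists_point_of_isPreorder hP hP1
  exact ⟨x, hom_eq_of_ker_le hχ rfl fun p hp => hx p.1 ⟨p, hp, fun _ h => h⟩⟩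

theorem IsSpaceOfOrderings.exists_separating (hG : IsSpaceOfOrderings G) (hSAP : IsSAP G)
    (x : X) (s : Finset X) (hx : x ∉ s) :
    ∃ e : G, e.1 x = -1 ∧ ∀ y ∈ s, e.1 y = 1 := by
  classical
  induction s using Finset.induction_on with
  | empty => exact ⟨hG.negOne, rfl, by simp⟩
  | insert y s _ ih =>
    rw [Finset.mem_insert, not_or] at hx
    obtain ⟨e, he, hes⟩ := ih hx.2
    obtain ⟨a, ha, hne⟩ := hG.separates x y hx.1
    have hb : ∃ b : G, b.1 x = -1 ∧ b.1 y = 1 := by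
      rcases Int.units_eq_one_or (a y) with h | h
      · exact ⟨⟨a, ha⟩, (Int.units_eq_one_or (a x)).resolve_left (h ▸ hne), h⟩
      · refine ⟨hG.negOne * ⟨a, ha⟩, ?_, ?_⟩
        · change -1 * a x = -1
          rw [(Int.units_eq_one_or (a x)).resolve_right (h ▸ hne), mul_one]
        · change -1 * a y = 1
          rw [h]; rfl
    obtain ⟨b, hb1, hb2⟩ := hb
    obtain ⟨g, hg⟩ := hG.exists_glue hSAP b e
    refine ⟨g, by rw [hg, hb1, he]; rfl, fun z hz => ?_⟩
    rw [hg]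
    rcases Finset.mem_insert.1 hz with rfl | hz
    · exact if_pos hb2
    · rw [hes z hz]; exact ite_self _

/-- In a fan with four points, `d` is forced to satisfy the relation between the points if it
is forced at each of the points. -/
theorem prod_eq_one_of_forced {a₁ a₂ a₃ b c d : Fin 4 → ℤˣ}
    (hb : ∀ i, b i = a₁ i ∨ b i = c i) (hc : ∀ i, c i = a₂ i ∨ c i = a₃ i)
    (hd : ∀ i, b i = d i ∨ b i = a₃ i) (hd' : ∀ i, d i = a₁ i ∨ d i = a₂ i)
    (hforced : ∀ i, b i = a₃ i → a₁ i = a₂ i)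
    (h₁ : ∏ i, a₁ i = 1) (h₂ : ∏ i, a₂ i = 1) (h₃ : ∏ i, a₃ i = 1) (h₄ : ∏ i, b i = 1)
    (h₅ : ∏ i, c i = 1) : ∏ i, d i = 1 := by
  -- After division by `a₃` only six sign patterns remain, one per column. The product conditions
  -- force the numbers of indices of types 0, 1, 2, 3 and 5 to have equal parity. Odd parity would
  -- need five indices, so with four all are even and `d` has product 1.
  let A₁ : Fin 6 → ℤˣ := ![-1, -1, -1, 1, 1, -1]
  let A₂ : Fin 6 → ℤˣ := ![1, -1, -1, -1, 1, -1]
  let B : Fin 6 → ℤˣ := ![-1, -1, -1, -1, 1, 1]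
  let C : Fin 6 → ℤˣ := ![1, 1, -1, -1, 1, 1]
  let D : Fin 6 → ℤˣ := ![-1, -1, -1, -1, 1, -1]
  have types : ∀ a₁ a₂ a₃ b c d : ℤˣ, (b = a₁ ∨ b = c) → (c = a₂ ∨ c = a₃) →
      (b = d ∨ b = a₃) → (d = a₁ ∨ d = a₂) → (b = a₃ → a₁ = a₂) →
      ∃ t, a₁ = a₃ * A₁ t ∧ a₂ = a₃ * A₂ t ∧ b = a₃ * B t ∧ c = a₃ * C t ∧ d = a₃ * D t := by
    set_option synthInstance.maxHeartbeats 200000 in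
    set_option synthInstance.maxSize 1000 in
    decide +kernel
  have table : ∀ t₀ t₁ t₂ t₃ : Fin 6, A₁ t₀ * A₁ t₁ * A₁ t₂ * A₁ t₃ = 1 →
      A₂ t₀ * A₂ t₁ * A₂ t₂ * A₂ t₃ = 1 → B t₀ * B t₁ * B t₂ * B t₃ = 1 →
      C t₀ * C t₁ * C t₂ * C t₃ = 1 → D t₀ * D t₁ * D t₂ * D t₃ = 1 := by
    decide +kernel
  choose t e₁ e₂ e₃ e₄ e₅ using fun i =>
    types _ _ _ _ _ _ (hb i) (hc i) (hd i) (hd' i) (hforced i)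
  simp only [e₁, e₂, e₃, e₄, Finset.prod_mul_distrib, h₃, one_mul] at h₁ h₂ h₄ h₅
  simp only [e₅, Finset.prod_mul_distrib, h₃, one_mul]
  rw [Fin.prod_univ_four] at *
  exact table _ _ _ _ h₁ h₂ h₄ h₅

/-! ### Products of two and of four points -/

theorem IsSpaceOfOrderings.isQuotientSpace_of_two (hG : IsSpaceOfOrderings G) (hSAP : IsSAP G)
    {G₀ : Subgroup G} (hneg : hG.negOne ∈ G₀) {x y : X}
    (hG₀ : ∀ g : G, g ∈ G₀ ↔ g.1 x = g.1 y) : IsQuotientSpace G G₀ := by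
  refine hG.isQuotientSpace hneg (fun χ hχ hker => ?_) ?_
  · refine hG.exists_comp_eq hSAP hneg hχ hker (m := 1) (map_one χ) ?_
    intro p hp q hq r hr
    rw [hG₀] at *
    rw [hr, hr, hp, hq]
    rfl
  · intro a₁ a₂ a₃ b c h₁ h₂ h₃ h₄ h₅ hb hc
    -- The witness is `a₁` where `b = a₃` and `b` elsewhere; where `b ≠ a₃` and `b ≠ a₁`,
    -- necessarily `b = c = a₂`.
    obtain ⟨e, he⟩ := hG.exists_glue hSAP (b * a₃) (a₁ * b)
    refine ⟨a₁ * e, ?_, fun z => ?_, fun z => ?_⟩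
    · rw [hG₀] at *
      simp only [coe_mul_apply, he, h₁, h₃, h₄]
    · rw [coe_mul_apply, he, coe_mul_apply, coe_mul_apply]
      generalize a₁.1 z = p
      generalize a₃.1 z = q
      generalize b.1 z = r
      revert p q r
      decide
    · have hbz := hb z
      have hcz := hc z
      rw [coe_mul_apply, he, coe_mul_apply, coe_mul_apply]
      generalize a₁.1 z = p at *
      generalize a₂.1 z = p' at *
      generalize a₃.1 z = q at *
      generalize b.1 z = r at *
      generalize c.1 z = s at *
      clear * - hbz hcz
      revert p p' q r s
      decide

theorem IsSpaceOfOrderings.isQuotientSpace_of_four (hG : IsSpaceOfOrderings G)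
    (hSAP : IsSAP G) {G₀ : Subgroup G} (hneg : hG.negOne ∈ G₀) {σ : Fin 4 → X}
    (hσ : Function.Injective σ) (hG₀ : ∀ g : G, g ∈ G₀ ↔ ∏ i, g.1 (σ i) = 1) :
    IsQuotientSpace G G₀ := by
  classical
  refine hG.isQuotientSpace hneg (fun χ hχ hker => ?_) ?_
  · by_cases hk : ∃ k : G₀, (∀ i, k.1.1 (σ i) = 1) ∧ χ k = -1
    · obtain ⟨k, hk, hkχ⟩ := hk
      -- Infima with `-k` are -1 at all four points, so they lie in `G₀`.
      refine hG.exists_comp_eq hSAP hneg hχ hker (m := ⟨hG.negOne, hneg⟩ * k)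
        (by rw [map_mul, hχ, hkχ]; rfl) ?_
      intro p _ q _ r hr
      have : ∀ i, r.1 (σ i) = -1 := by
        intro i
        rw [hr]
        apply if_neg
        change -1 * k.1.1 (σ i) ≠ 1
        rw [hk i]
        decide
      rw [hG₀]
      simp only [this]
      decide
    -- Now `χ` is trivial on the common kernel of the four restricted points, any three of which
    -- determine the fourth on `G₀`.
    · push Not at hk
      let y : Fin 4 → G₀ →* ℤˣ := fun i => (evalChar G (σ i)).comp G₀.subtype
      have h4 : y 3 = y 0 * y 1 * y 2 := by
        ext1 g
        have := (hG₀ g.1).1 g.2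
        rw [Fin.prod_univ_four] at this
        exact (units_eq_of_mul_eq_one this).symm
      rcases hom_eq_of_three_kers (x₁ := y 0) (x₂ := y 1) (x₃ := y 2) hχ rfl rfl rfl (by
        intro k h0 h1 h2
        have h3 : y 3 k = 1 := by
          rw [h4, MonoidHom.mul_apply, MonoidHom.mul_apply, h0, h1, h2]; rfl
        refine (Int.units_eq_one_or (χ k)).resolve_right (hk k ?_)
        intro i
        fin_cases i
        exacts [h0, h1, h2, h3]) with e | e | e | e
      · exact ⟨σ 0, e.symm⟩
      · exact ⟨σ 1, e.symm⟩
      · exact ⟨σ 2, e.symm⟩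
      · exact ⟨σ 3, h4.trans e.symm⟩
  · intro a₁ a₂ a₃ b c h₁ h₂ h₃ h₄ h₅ hb hc
    obtain ⟨d, hd, hd'⟩ := hG.assoc a₁ a₂ a₃ b c hb hc
    by_cases hdG : d ∈ G₀
    · exact ⟨d, hdG, hd, hd'⟩
    -- At such a point both signs of `d` are admissible.
    have hfree : ∃ i, b.1 (σ i) = a₃.1 (σ i) ∧ a₁.1 (σ i) ≠ a₂.1 (σ i) := by
      by_contra! hforced
      apply hdG
      rw [hG₀] at *
      exact prod_eq_one_of_forced (fun i => hb (σ i)) (fun i => hc (σ i)) (fun i => hd (σ i))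
        (fun i => hd' (σ i)) hforced h₁ h₂ h₃ h₄ h₅
    obtain ⟨i, hi, hi'⟩ := hfree
    obtain ⟨e, he, he'⟩ := hG.exists_separating hSAP (σ i) ((Finset.univ.erase i).image σ) (by
      simp only [Finset.mem_image, Finset.mem_erase, Finset.mem_univ, and_true, not_exists,
        not_and]
      exact fun j hj h => hj (hσ h))
    -- `z` is -1 exactly where `e = -1`, `b = a₃` and `a₁ ≠ a₂`. Multiplying by it flips `d` only
    -- where that is allowed, and among the `σ j` only at `σ i`.
    obtain ⟨u, hu⟩ := hG.exists_glue hSAP (a₁ * a₂) hG.negOne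
    obtain ⟨v, hv⟩ := hG.exists_glue hSAP (hG.negOne * (b * a₃)) u
    obtain ⟨z, hz⟩ := hG.exists_glue hSAP e v
    have glue : ∀ p q r s t : ℤˣ,
        (if s = 1 then 1 else if -1 * (t * r) = 1 then 1 else if p * q = 1 then 1 else -1) =
          (1 : ℤˣ) ∨
        (if s = 1 then 1 else if -1 * (t * r) = 1 then 1 else if p * q = 1 then 1 else -1) =
          (-1 : ℤˣ) ∧ t = r ∧ p ≠ q := by
      decide
    have hz' : ∀ x, z.1 x = 1 ∨ z.1 x = -1 ∧ b.1 x = a₃.1 x ∧ a₁.1 x ≠ a₂.1 x := by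
      intro x
      rw [hz, hv, hu]
      exact glue _ _ _ _ _
    refine ⟨d * z, ?_, fun x => ?_, fun x => ?_⟩
    · have hzi : z.1 (σ i) = -1 := by
        rw [hz, hv, hu, he, coe_mul_apply, coe_mul_apply, coe_mul_apply, hi,
          Int.units_mul_self, if_neg (show ¬(-1 : ℤˣ) = 1 by decide),
          if_neg (show ¬hG.negOne.1 (σ i) * 1 = 1 by rw [hG.negOne_apply]; decide),
          if_neg fun h => hi' (units_eq_of_mul_eq_one h), hG.negOne_apply]
      have hzj : ∀ j, j ≠ i → z.1 (σ j) = 1 := by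
        intro j hj
        rw [hz]
        exact if_pos (he' _ (Finset.mem_image_of_mem _ (by simp [hj])))
      have hprod : ∏ j, z.1 (σ j) = -1 := by
        rw [Finset.prod_eq_single i (fun j _ hj => hzj j hj) (by simp), hzi]
      rw [hG₀] at hdG ⊢
      simp only [coe_mul_apply, Finset.prod_mul_distrib]
      rw [hprod, (Int.units_eq_one_or _).resolve_left hdG]
      rfl
    · rcases hz' x with h | ⟨_, h, _⟩
      · rw [coe_mul_apply, h, mul_one]; exact hd x
      · exact Or.inr h
    · rcases hz' x with h | ⟨h, _, h'⟩
      · rw [coe_mul_apply, h, mul_one]; exact hd' x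
      · have := hd' x
        rw [coe_mul_apply, h]
        generalize a₁.1 x = p at *
        generalize a₂.1 x = q at *
        generalize d.1 x = r at *
        clear * - this h'
        revert p q r
        decide

end SpaceOfOrderings

theorem mainTheorem2 {X : Type*} (G : Subgroup (X → ℤˣ))
    (hG : SpaceOfOrderings.IsSpaceOfOrderings G) (hSAP : SpaceOfOrderings.IsSAP G)
    (G₀ : Subgroup G) (hneg : (⟨-1, hG.neg_one_mem⟩ : G) ∈ G₀) (hindex : G₀.index = 2)
    (γ : G →* ℤˣ) (hγ : γ.ker = G₀) (hγ4 : γ ∈ SpaceOfOrderings.charPow G 4) :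
    SpaceOfOrderings.IsQuotientSpace G G₀ := by
  have hmem : ∀ g : G, g ∈ G₀ ↔ γ g = 1 := fun g => by rw [← hγ, MonoidHom.mem_ker]
  obtain ⟨σ, hσ⟩ := hγ4
  have hval : ∀ g : G, γ g = ∏ i, g.1 (σ i) := fun g => by
    rw [hσ, MonoidHom.finsetProd_apply]; rfl
  by_cases hinj : Function.Injective σ
  · exact hG.isQuotientSpace_of_four hSAP hneg hinj fun g => by rw [hmem, hval]
  · simp only [Function.Injective, not_forall] at hinj
    obtain ⟨i, j, hij, hne⟩ := hinj
    -- The two equal factors cancel, leaving the points with the two other indices.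
    have hperm : ∀ i j : Fin 4, i ≠ j →
        ∃ k l : Fin 4, (Finset.univ : Finset (Fin 4)).val = {i, j, k, l} := by decide
    obtain ⟨k, l, hkl⟩ := hperm i j hne
    refine hG.isQuotientSpace_of_two hSAP hneg (x := σ k) (y := σ l) fun g => ?_
    rw [hmem, hval, Finset.prod_eq_multiset_prod, hkl]
    simp only [Multiset.insert_eq_cons, Multiset.map_cons, Multiset.prod_cons,
      Multiset.map_singleton, Multiset.prod_singleton]
    rw [hij, ← mul_assoc, Int.units_mul_self, one_mul]
    exact ⟨SpaceOfOrderings.units_eq_of_mul_eq_one, fun h => by rw [h, Int.units_mul_self]⟩
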